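/- Let $d\ge 1$, let $\mathcal A$ be a finite alphabet with the discrete topology, and let $X\subseteq\mathcal A^{\mathbb Z^d}$ be a subshift of finite type: $X$ is the set of all configurations in which no pattern from some finite collection of patterns appears. Let $\sigma^k(x)=(x_{i+k})_{i\in\mathbb Z^d}$ be the shift action of $\mathbb Z^d$, $\|k\|=\max_l|k_l|$, $\Lambda_n=\{i\in\mathbb Z^d:\|i\|<n\}$, and let $\rho$ be the metric on $X$ with $\rho(x,y)=2^{-n(x,y)}$ for $x\neq y$, where $n(x,y)=\max\{n\ge 0:x_{\Lambda_n}=y_{\Lambda_n}\}$. Let $f:X\to\mathbb R$ have $d$-summable variation, i.e. $\sum_{n\ge1}n^{d-1}\delta_n(f)<\infty$ with $\delta_n(f)=\sup\{|f(x)-f(y)|:x_{\Lambda_n}=y_{\Lambda_n}\}\in[0,\infty]$. Let $\mathfrak T\subseteq X\times X$ be the Gibbs relation, consisting of the pairs that agree outside a finite subset of $\mathbb Z^d$, and for $(x,y)\in\mathfrak T$ put $$c_f(x,y)=\sum_{k\in\mathbb Z^d}\bigl(f(\sigma^k y)-f(\sigma^k x)\bigr)\qquad\text{(unordered sum)}.$$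 A Borel probability measure $\mu$ on $X$ is called a *Gibbs measure* for $f$ if it is $(c_f,\mathfrak T)$-conformal, that is: (1) $\mu$ is quasi-invariant under $\mathfrak T$ (every Borel set $S$ with $\mu(S)=0$ has a $\mathfrak T$-saturation of $\mu$-measure zero); and (2) the measures $\nu_r(C)=\int_X|\{y:(x,y)\in C\}|\,d\mu(x)$ and $\nu_s(C)=\int_X|\{y:(y,x)\in C\}|\,d\mu(x)$ on the Borel subsets of $\mathfrak T$ satisfy $\frac{d\nu_r}{d\nu_s}=e^{-c_f}$ almost everywhere. Consider all pairs $(O,\varphi)$ where $O\subseteq X$ is open and $\varphi:O\to X$ is a *conjugating homeomorphism* on $O$: a homeomorphism of $O$ onto $\varphi(O)$ such that $\rho(\sigma^kx,\sigma^k\varphi(x))\to0$ as $\|k\|\to\infty$, uniformly in $x\in O$. A *family of multipliers* is a family $(R_{(O,\varphi)})$ of positive continuous functions $R_{(O,\varphi)}$ on $O$, indexed by all these pairs, such that (i) $R_{(O',\varphi')}=R_{(O,\varphi)}|_{O'}$ whenever $O'\subseteq O$ and $\varphi'=\varphi|_{O'}$; and (ii) $R_{(O,\varphi''\circ\varphi'|_O)}=R_{(O',\varphi')}|_O\cdot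 R_{(O'',\varphi'')}\circ\varphi'|_O$ whenever $O\subseteq O'$ and $\varphi'(O)\subseteq O''$. A Borel probability measure $\mu$ on $X$ is a *Gibbs state* for this family if $$\varphi_*\bigl(R_{(O,\varphi)}\,d\mu_O\bigr)=\mu_{\varphi(O)}\qquad\text{for every pair }(O,\varphi),$$ where $\mu_B$ denotes the restriction of $\mu$ to the Borel subsets of $B$. **Theorem.** The sum defining $c_f$ converges for every $(x,y)\in\mathfrak T$, the functions $R_{(O,\varphi)}(x)=e^{c_f(x,\varphi(x))}$, $x\in O$, form a family of multipliers, and a Borel probability measure $\mu$ on $X$ is a Gibbs measure for $f$ if and only if $\mu$ is a Gibbs state for this family of multipliers. -/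

import Mathlib

open MeasureTheory TopologicalSpace
open scoped ENNReal

noncomputable section

namespace GibbsShift

/-! ### Shift spaces -/

/-- The configurations `x = (x_i)` of the full shift `A^(ℤ^d)`. -/
abbrev Config (d : ℕ) (A : Type*) := (Fin d → ℤ) → A

section FullShift

variable {d : ℕ} {A : Type*}

/-- The translation `σ^j (x) = (x_{i+j})_i`. -/
def fullShift (j : Fin d → ℤ) (x : Config d A) : Config d A := fun i => x (i + j)

/-- The box `Λ_n = {i : ‖i‖ < n}`, where `‖i‖ = max_l |i_l|`. -/
def box (d n : ℕ) : Set (Fin d → ℤ) := {i | ‖i‖ < n}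

/-- `x` and `y` have the same restriction to the set `S` of sites. -/
def AgreeOn (S : Set (Fin d → ℤ)) (x y : Config d A) : Prop := ∀ i ∈ S, x i = y i

open Classical in
/-- The metric of the full shift: `ρ(x,x) = 0`, and for `x ≠ y`, `ρ(x,y) = 2^(-n(x,y))` with
`n(x,y) = max {n ≥ 0 : x and y agree on Λ_n}`. -/
def rho (x y : Config d A) : ℝ :=
  if x = y then 0 else ((2 : ℝ) ^ sSup {n : ℕ | AgreeOn (box d n) x y})⁻¹

end FullShift

/-- A pattern: a finite set `Λ` of sites together with an element of `A^Λ`. -/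
abbrev Pattern (d : ℕ) (A : Type*) := Σ Λ : Finset (Fin d → ℤ), (Λ → A)

/-- The set of configurations in which no pattern of `F` appears. -/
def avoiding {d : ℕ} {A : Type*} (F : Set (Pattern d A)) : Set (Config d A) :=
  {x | ∀ (j : Fin d → ℤ) (Λ : Finset (Fin d → ℤ)),
    (⟨Λ, fun i => fullShift j x i⟩ : Pattern d A) ∉ F}

/-- A subshift: a closed subset of the full shift which is invariant under translations. -/
structure Subshift (d : ℕ) (A : Type*) [TopologicalSpace A] where
  carrier : Set (Config d A)
  isClosed : IsClosed carrier
  shift_mem : ∀ (j : Fin d → ℤ), ∀ x ∈ carrier, fullShift j x ∈ carrier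

/-- The set of points of a subshift, as a type, with the topology and the `σ`-algebra induced from
the product. -/
instance Subshift.instCoeSort {d : ℕ} {A : Type*} [TopologicalSpace A] : CoeSort (Subshift d A) (Type _) :=
  ⟨fun X => X.carrier⟩

section Subshift

variable {d : ℕ} {A : Type*} [TopologicalSpace A]

/-- Subshifts of finite type: those given by a finite collection of forbidden patterns. -/
def Subshift.IsSFT (X : Subshift d A) : Prop :=
  ∃ F : Set (Pattern d A), F.Finite ∧ X.carrier = avoiding F

variable {X : Subshift d A}

/-- The shift action on a subshift. -/
def shift (j : Fin d → ℤ) (x : X) : X := ⟨fullShift j x.1, X.shift_mem j x.1 x.2⟩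

/-- The `n`-th variation `δ_n(f)`, an extended non-negative real number. -/
def variation (f : X → ℝ) (n : ℕ) : ℝ≥0∞ :=
  ⨆ (x : X) (y : X) (_ : AgreeOn (box d n) x.1 y.1), ENNReal.ofReal |f x - f y|

/-- `f ∈ SV_d(X)`: the function `f` has `d`-summable variation,
`∑_{n ≥ 1} n^(d-1) δ_n(f) < ∞`. -/
def HasSummableVariation (f : X → ℝ) : Prop :=
  ∑' n : ℕ, ((n + 1 : ℕ) : ℝ≥0∞) ^ (d - 1) * variation f (n + 1) < ∞

/-- The Gibbs relation: pairs of points of `X` that agree outside a finite set of sites. -/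
def gibbsRel (X : Subshift d A) : Set (X × X) :=
  {p | ∃ Λ : Finset (Fin d → ℤ), AgreeOn (Λ : Set (Fin d → ℤ))ᶜ p.1.1 p.2.1}

/-- `c_f(x,y) = ∑_{k ∈ ℤ^d} (f(σ^k y) - f(σ^k x))`, an unordered sum; it is used for `(x,y)` in
the Gibbs relation. -/
def cocycle (f : X → ℝ) (x y : X) : ℝ :=
  ∑' k : Fin d → ℤ, (f (shift k y) - f (shift k x))

end Subshift

/-! ### Conformal measures for a (countable Borel equivalence) relation `R` on `Y` -/

section Conformal

variable {Y : Type*} [MeasurableSpace Y]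

/-- The `R`-saturation of `S`. -/
def saturation (R : Set (Y × Y)) (S : Set Y) : Set Y := {y | ∃ x ∈ S, (x, y) ∈ R}

/-- `μ` is quasi-invariant under `R`. -/
def QuasiInvariant (R : Set (Y × Y)) (μ : Measure Y) : Prop :=
  ∀ S : Set Y, MeasurableSet S → μ S = 0 → μ (saturation R S) = 0

/-- The left counting measure on `R`: `ν_r(C) = ∫ |r⁻¹{x} ∩ C| dμ(x)`, with `r(x,y) = x`,
i.e. the mixture over `μ` of the counting measures on the fibres of `r`. (When `R` is a countable
Borel equivalence relation, such as the Gibbs relation of a subshift, these counting measures depend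
measurably on `x`, so that `Measure.bind` is given by this integral.) -/
def leftCounting (R : Set (Y × Y)) (μ : Measure Y) : Measure R :=
  μ.bind fun x => Measure.count.restrict {p : R | p.1.1 = x}

/-- The right counting measure on `R`: `ν_s(C) = ∫ |s⁻¹{x} ∩ C| dμ(x)`, with `s(x,y) = y`. -/
def rightCounting (R : Set (Y × Y)) (μ : Measure Y) : Measure R :=
  μ.bind fun x => Measure.count.restrict {p : R | p.1.2 = x}

/-- `μ` is `(c, R)`-conformal: `μ` is quasi-invariant under `R` and its Radon-Nikodym derivative
`D = dν_r/dν_s` with respect to `R` equals `e^{-c}` almost everywhere. -/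
def IsConformal (R : Set (Y × Y)) (c : R → ℝ) (μ : Measure Y) : Prop :=
  QuasiInvariant R μ ∧
    (leftCounting R μ).rnDeriv (rightCounting R μ) =ᵐ[leftCounting R μ]
      fun p => ENNReal.ofReal (Real.exp (-c p))

end Conformal

section Gibbs

variable {d : ℕ} {A : Type*} [TopologicalSpace A] {X : Subshift d A}

/-- Gibbs measures for `f`: the `(c_f, 𝔗)`-conformal measures, `𝔗` being the Gibbs relation. -/
def IsGibbsMeasure [MeasurableSpace A] (f : X → ℝ) (μ : Measure X) : Prop :=
  IsConformal (gibbsRel X) (fun p => cocycle f p.1.1 p.1.2) μ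

/-! ### Capocaccia's Gibbs states -/

/-- A mapping `φ : O → X` is conjugating if `ρ(σ^k x, σ^k φ(x))` tends to zero as `‖k‖ → ∞`,
uniformly in `x ∈ O`. -/
def IsConjugating {O : Opens X} (φ : O → X) : Prop :=
  ∀ ε : ℝ, 0 < ε → ∃ N : ℝ, ∀ k : Fin d → ℤ, N ≤ ‖k‖ →
    ∀ x : O, rho (shift k x.1).1 (shift k (φ x)).1 < ε

/-- The pairs `(O, φ)`: an open set `O` of `X` together with a conjugating mapping `φ : O → X`
that is a homeomorphism of `O` onto its image `φ(O)`. -/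
structure ConjHomeo (X : Subshift d A) where
  dom : Opens X
  toFun : dom → X
  isEmbedding : Topology.IsEmbedding toFun
  isConjugating : IsConjugating toFun

/-- Families of multipliers `(R_{(O,φ)})`, indexed by all pairs `(O,φ)`. -/
structure IsFamilyOfMultipliers (R : (p : ConjHomeo X) → p.dom → ℝ) : Prop where
  pos : ∀ p x, 0 < R p x
  continuous : ∀ p, Continuous (R p)
  restrict : ∀ (p p' : ConjHomeo X) (h : p'.dom ≤ p.dom),
    (∀ x : p'.dom, p'.toFun x = p.toFun ⟨x, h x.2⟩) →
    ∀ x : p'.dom, R p' x = R p ⟨x, h x.2⟩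
  comp : ∀ (p p' p'' : ConjHomeo X) (h : p.dom ≤ p'.dom)
    (h' : ∀ x : p.dom, p'.toFun ⟨x, h x.2⟩ ∈ p''.dom),
    (∀ x : p.dom, p.toFun x = p''.toFun ⟨p'.toFun ⟨x, h x.2⟩, h' x⟩) →
    ∀ x : p.dom, R p x = R p' ⟨x, h x.2⟩ * R p'' ⟨p'.toFun ⟨x, h x.2⟩, h' x⟩

/-- `μ` is a Gibbs state for the family `R`: `φ_*(R_{(O,φ)} dμ_O) = μ_{φ(O)}` for all `(O,φ)`.
Both sides are regarded as measures on `X` that live on `φ(O)`. -/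
def IsGibbsState [MeasurableSpace A] (R : (p : ConjHomeo X) → p.dom → ℝ) (μ : Measure X) : Prop :=
  ∀ p : ConjHomeo X,
    ((μ.comap (Subtype.val : p.dom → X)).withDensity fun x => ENNReal.ofReal (R p x)).map p.toFun
      = μ.restrict (Set.range p.toFun)

/-- The family `R_{(O,φ)}(x) = e^{c_f(x, φ(x))}`. -/
def gibbsMultiplier (f : X → ℝ) (p : ConjHomeo X) (x : p.dom) : ℝ :=
  Real.exp (cocycle f x.1 (p.toFun x))

end Gibbs

end GibbsShift

end

open GibbsShift

/-! Both notions say the same thing on graphs of conjugating homeomorphisms. Pull the counting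
measures back along the graph map x ↦ (x, φ(x)) of a pair (O, φ): since `r` and `s` are injective on
the graph, ν_r becomes μ on O and ν_s becomes the pullback of μ by φ (`comap_graph_leftCounting`,
`comap_graph_rightCounting`). Hence ν_r = e^{-c_f} ν_s on the graph means e^{c_f} μ_O = φ^*μ, which
is the Gibbs state equation for (O, φ).

This is a global statement because countably many such graphs cover the Gibbs relation
(`Subshift.IsSFT.exists_cover`). Finite type enters only here: two points that differ on a finite
set are related by an exchange of patterns on a larger finite set, and that exchange is allowed
wherever the first pattern occurs. Quasi-invariance corresponds to mutual absolute continuity of ν_r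
and ν_s on each graph, so the Radon-Nikodym derivative is a true density.

The cocycle is controlled by counting: O(m^{d-1}) sites have norm m, and if x, y agree at all sites
of norm at least N, then σ^k x, σ^k y agree on a box of radius about ‖k‖ - N. The resulting summable
bound depends only on N, which yields convergence, and continuity of the multipliers as well. -/

namespace GibbsShift

/-! ### Counting measures along the fibres of a countable-to-one map -/

section FiberCounting

variable {Ω Y Z : Type*} [MeasurableSpace Ω] [MeasurableSpace Y] [MeasurableSpace Z]

/-- The mixture over `μ` of the counting measures on the fibres of `q`. -/
noncomputable def fiberCounting (q : Ω → Y) (μ : Measure Y) : Measure Ω :=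
  μ.bind fun x => Measure.count.restrict {p : Ω | q p = x}

/-- A map which is injective with measurable images on each set of a countable measurable cover. -/
structure IsCountableToOne (q : Ω → Y) (E : ℕ → Set Ω) : Prop where
  measurable : Measurable q
  measurableSet : ∀ n, MeasurableSet (E n)
  cover : ⋃ n, E n = Set.univ
  injOn : ∀ n, Set.InjOn q (E n)
  image : ∀ n, ∀ C ⊆ E n, MeasurableSet C → MeasurableSet (q '' C)

theorem count_restrict_fiber_apply [MeasurableSingletonClass Ω] [MeasurableSingletonClass Y]
    {q : Ω → Y} {C : Set Ω} (hC : MeasurableSet C) (hinj : Set.InjOn q C)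
    (x : Y) :
    Measure.count.restrict {p : Ω | q p = x} C = (q '' C).indicator 1 x := by
  rw [Measure.restrict_apply hC]
  by_cases hx : x ∈ q '' C
  · obtain ⟨p, hp, rfl⟩ := hx
    have : C ∩ {p' | q p' = q p} = {p} := by
      ext p'
      simp only [Set.mem_inter_iff, Set.mem_ofPred_eq, Set.mem_singleton_iff]
      exact ⟨fun h => hinj h.1 hp h.2, by rintro rfl; exact ⟨hp, rfl⟩⟩
    rw [this, Measure.count_singleton, Set.indicator_of_mem (Set.mem_image_of_mem q hp)]
    rfl
  · have : C ∩ {p' | q p' = x} = ∅ := by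
      ext p'
      simp only [Set.mem_inter_iff, Set.mem_ofPred_eq, Set.mem_empty_iff_false, iff_false]
      exact fun h => hx ⟨p', h.1, h.2⟩
    rw [this, measure_empty, Set.indicator_of_notMem hx]

/-- Without this measurability `Measure.bind` would not be given by the integral of the fibre
counts. Cutting a set along the disjointed cover turns the count into a countable sum of indicators.
-/
theorem IsCountableToOne.measurable_count [MeasurableSingletonClass Ω]
    [MeasurableSingletonClass Y] {q : Ω → Y} {E : ℕ → Set Ω} (h : IsCountableToOne q E) :
    Measurable fun x : Y => (Measure.count.restrict {p : Ω | q p = x} : Measure Ω) := by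
  refine Measure.measurable_of_measurable_coe _ fun C hC => ?_
  have hD : ∀ n, MeasurableSet (C ∩ disjointed E n) := fun n =>
    hC.inter (MeasurableSet.disjointed h.measurableSet n)
  have hDE : ∀ n, C ∩ disjointed E n ⊆ E n := fun n =>
    Set.inter_subset_right.trans (disjointed_subset E n)
  have hCD : C = ⋃ n, C ∩ disjointed E n := by
    rw [← Set.inter_iUnion, iUnion_disjointed, h.cover, Set.inter_univ]
  have hdisj : Pairwise (Function.onFun Disjoint fun n => C ∩ disjointed E n) := fun i j hij =>
    ((disjoint_disjointed E) hij).mono Set.inter_subset_right Set.inter_subset_right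
  have key : ∀ x : Y, Measure.count.restrict {p : Ω | q p = x} C =
      ∑' n, (q '' (C ∩ disjointed E n)).indicator 1 x := by
    intro x
    conv_lhs => rw [hCD]
    rw [measure_iUnion hdisj hD]
    exact tsum_congr fun n =>
      count_restrict_fiber_apply (hD n) ((h.injOn n).mono (hDE n)) x
  simp only [key]
  exact Measurable.tsum fun n =>
    measurable_one.indicator (h.image n _ (hDE n) (hD n))

theorem IsCountableToOne.fiberCounting_apply [MeasurableSingletonClass Ω]
    [MeasurableSingletonClass Y] {q : Ω → Y} {E : ℕ → Set Ω} (h : IsCountableToOne q E)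
    (μ : Measure Y) {C : Set Ω} (hC : MeasurableSet C) (hinj : Set.InjOn q C)
    (himg : MeasurableSet (q '' C)) : fiberCounting q μ C = μ (q '' C) := by
  rw [fiberCounting, Measure.bind_apply hC h.measurable_count.aemeasurable]
  simp only [count_restrict_fiber_apply hC hinj]
  exact lintegral_indicator_one himg

/-- Each fibre of `q` meets the image of `γ` at most once, so counting there reduces to evaluating
`μ` on the projected set. -/
theorem IsCountableToOne.comap_fiberCounting [MeasurableSingletonClass Ω]
    [MeasurableSingletonClass Y] {q : Ω → Y} {E : ℕ → Set Ω} (h : IsCountableToOne q E)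
    (μ : Measure Y) {γ : Z → Ω} (hγ : MeasurableEmbedding γ)
    (hqγ : MeasurableEmbedding fun z => q (γ z)) :
    (fiberCounting q μ).comap γ = μ.comap fun z => q (γ z) := by
  ext S hS
  rw [hγ.comap_apply, hqγ.comap_apply]
  have himg : q '' (γ '' S) = (fun z => q (γ z)) '' S := Set.image_image _ _ _
  rw [h.fiberCounting_apply μ (hγ.measurableSet_image.2 hS), himg]
  · rintro _ ⟨z, -, rfl⟩ _ ⟨z', -, rfl⟩ hz
    rw [hqγ.injective hz]
  · rw [himg]
    exact hqγ.measurableSet_image.2 hS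

theorem IsCountableToOne.sigmaFinite_fiberCounting [MeasurableSingletonClass Ω]
    [MeasurableSingletonClass Y] {q : Ω → Y} {E : ℕ → Set Ω} (h : IsCountableToOne q E)
    (μ : Measure Y) [IsFiniteMeasure μ] : SigmaFinite (fiberCounting q μ) := by
  refine Measure.sigmaFinite_of_countable (S := Set.range E) (Set.countable_range E) ?_ ?_
  · rintro _ ⟨n, rfl⟩
    rw [h.fiberCounting_apply μ (h.measurableSet n) (h.injOn n)
      (h.image n _ subset_rfl (h.measurableSet n))]
    exact measure_lt_top _ _
  · rw [Set.sUnion_range, h.cover]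

/-- A map is countable-to-one if the space is covered by countably many measurable embeddings
whose compositions with the map are measurable embeddings. -/
theorem isCountableToOne_range {q : Ω → Y} (hq : Measurable q) {Z : ℕ → Type*}
    [∀ n, MeasurableSpace (Z n)] {γ : (n : ℕ) → Z n → Ω} (hγ : ∀ n, MeasurableEmbedding (γ n))
    (hqγ : ∀ n, MeasurableEmbedding fun z => q (γ n z)) (hcover : ⋃ n, Set.range (γ n) = Set.univ) :
    IsCountableToOne q fun n => Set.range (γ n) where
  measurable := hq
  measurableSet n := (hγ n).measurableSet_range
  cover := hcover
  injOn n := by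
    rintro _ ⟨z, rfl⟩ _ ⟨z', rfl⟩ hz
    rw [(hqγ n).injective hz]
  image n C hC hCm := by
    have : q '' C = (fun z => q (γ n z)) '' (γ n ⁻¹' C) := by
      rw [← Set.image_image q (γ n), Set.image_preimage_eq_of_subset hC]
    rw [this]
    exact (hqγ n).measurableSet_image.2 ((hγ n).measurable hCm)

theorem _root_.MeasurableEmbedding.comap_withDensity {γ : Z → Ω} (hγ : MeasurableEmbedding γ)
    (ν : Measure Ω) (g : Ω → ℝ≥0∞) :
    (ν.withDensity g).comap γ = (ν.comap γ).withDensity fun z => g (γ z) := by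
  ext S hS
  rw [hγ.comap_apply, withDensity_apply _ (hγ.measurableSet_image.2 hS), withDensity_apply _ hS,
    hγ.restrict_comap, ← hγ.lintegral_map, hγ.map_comap,
    Measure.restrict_restrict hγ.measurableSet_range,
    Set.inter_eq_self_of_subset_right (Set.image_subset_range γ S)]

theorem measure_eq_of_comap_eq {Z : ℕ → Type*} [∀ n, MeasurableSpace (Z n)]
    {γ : (n : ℕ) → Z n → Ω} (hγ : ∀ n, MeasurableEmbedding (γ n))
    (hcover : ⋃ n, Set.range (γ n) = Set.univ) {ν ν' : Measure Ω}
    (h : ∀ n, ν.comap (γ n) = ν'.comap (γ n)) : ν = ν' :=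
  (Measure.ext_iff_of_iUnion_eq_univ hcover).2 fun n => by
    rw [← (hγ n).map_comap, ← (hγ n).map_comap, h n]

theorem absolutelyContinuous_of_comap {Z : ℕ → Type*} [∀ n, MeasurableSpace (Z n)]
    {γ : (n : ℕ) → Z n → Ω} (hγ : ∀ n, MeasurableEmbedding (γ n))
    (hcover : ⋃ n, Set.range (γ n) = Set.univ) {ν ν' : Measure Ω}
    (h : ∀ n, ν.comap (γ n) ≪ ν'.comap (γ n)) : ν ≪ ν' := by
  intro S hS
  have hSu : S = ⋃ n, γ n '' (γ n ⁻¹' S) := by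
    simp only [Set.image_preimage_eq_inter_range, ← Set.inter_iUnion, hcover, Set.inter_univ]
  rw [hSu, measure_iUnion_null_iff]
  intro n
  rw [← (hγ n).comap_apply]
  refine h n ?_
  rw [(hγ n).comap_apply]
  exact measure_mono_null (Set.image_preimage_subset _ _) hS

/-- The two densities are mutually inverse and nowhere 0 or ∞, so no finiteness of the measures is
needed. -/
theorem withDensity_exp_neg_iff {μ ν : Measure Ω} {g : Ω → ℝ} (hg : Measurable g) :
    μ = ν.withDensity (fun z => ENNReal.ofReal (Real.exp (-g z))) ↔
      μ.withDensity (fun z => ENNReal.ofReal (Real.exp (g z))) = ν := by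
  have key : ∀ (μ : Measure Ω) {g : Ω → ℝ}, Measurable g →
      (μ.withDensity fun z => ENNReal.ofReal (Real.exp (g z))).withDensity
        (fun z => ENNReal.ofReal (Real.exp (-g z))) = μ := by
    intro μ g hg
    convert withDensity_inv_same (μ := μ) (f := fun z => ENNReal.ofReal (Real.exp (g z)))
      (by fun_prop) (by simp [Real.exp_pos]) (by simp) using 3 with z
    rw [Real.exp_neg, ENNReal.ofReal_inv_of_pos (Real.exp_pos _)]
  constructor
  · rintro rfl
    simpa using key ν hg.neg
  · rintro rfl
    exact (key μ hg).symm

end FiberCounting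

/-! ### Counting lattice points by their norm -/

section Lattice

variable {d : ℕ}

theorem setOf_norm_le_eq_Icc (d m : ℕ) :
    {k : Fin d → ℤ | ‖k‖ ≤ m} = Set.Icc (fun _ => -(m : ℤ)) (fun _ => (m : ℤ)) := by
  ext k
  simp only [Set.mem_ofPred_eq, Set.mem_Icc, Pi.le_def, ← forall_and,
    pi_norm_le_iff_of_nonneg (Nat.cast_nonneg m : (0 : ℝ) ≤ m)]
  refine forall_congr' fun l => ?_
  rw [Int.norm_eq_abs, ← abs_le]
  exact_mod_cast Iff.rfl

theorem finite_setOf_norm_le (d m : ℕ) : {k : Fin d → ℤ | ‖k‖ ≤ m}.Finite := by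
  rw [setOf_norm_le_eq_Icc]
  exact Set.finite_Icc _ _

theorem finite_box (d n : ℕ) : (box d n).Finite :=
  (finite_setOf_norm_le d n).subset fun i (hi : ‖i‖ < n) => le_of_lt (a := ‖i‖) hi

theorem exists_nat_le_norm_notMem (Λ : Finset (Fin d → ℤ)) :
    ∃ N : ℕ, ∀ i : Fin d → ℤ, (N : ℝ) ≤ ‖i‖ → i ∉ Λ := by
  obtain ⟨B, hB⟩ := (Λ.image fun i => ‖i‖).bddAbove
  obtain ⟨N, hN⟩ := exists_nat_gt B
  refine ⟨N, fun i hi hmem => ?_⟩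
  have : ‖i‖ ≤ B := hB (by simpa using ⟨i, hmem, rfl⟩)
  linarith

/-- The shell lies in the difference of two cubes whose side lengths differ by 2; the estimate |a^d
- b^d| ≤ |a - b| d max(|a|, |b|)^{d-1} gives the order m^{d-1}. -/
theorem encard_floor_norm_le (hd : 0 < d) {m : ℕ} (hm : 0 < m) :
    ENat.card {k : Fin d → ℤ // ⌊‖k‖⌋₊ = m} ≤ (2 * d * (3 * m) ^ (d - 1) : ℕ) := by
  classical
  obtain ⟨m, rfl⟩ : ∃ j, m = j + 1 := ⟨m - 1, by omega⟩
  set I : ℕ → Finset (Fin d → ℤ) := fun m => Finset.Icc (fun _ => -(m : ℤ)) (fun _ => (m : ℤ))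
    with hI
  have hIcard : ∀ m, (I m).card = (2 * m + 1) ^ d := fun m => by
    simp only [hI, Pi.card_Icc, Int.card_Icc, Finset.prod_const, Finset.card_univ,
      Fintype.card_fin]
    congr 1
    omega
  have hmem : ∀ m k, k ∈ I m ↔ ‖k‖ ≤ m := fun m k => by
    have := Set.ext_iff.1 (setOf_norm_le_eq_Icc d m) k
    simp only [Set.mem_ofPred_eq] at this
    rw [this, hI, Finset.mem_Icc, Set.mem_Icc]
  have hsub : I m ⊆ I (m + 1) := fun k hk => by
    rw [hmem] at hk ⊢
    push_cast
    linarith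
  have hfib : {k : Fin d → ℤ | ⌊‖k‖⌋₊ = m + 1} ⊆ ((I (m + 1) \ I m : Finset _) : Set _) := by
    intro k hk
    have hk' : ⌊‖k‖⌋₊ = m + 1 := hk
    have hlt := Nat.lt_floor_add_one ‖k‖
    have hle := Nat.floor_le (norm_nonneg k)
    rw [hk'] at hlt hle
    push_cast at hlt hle
    rw [Finset.mem_coe, Finset.mem_sdiff]
    have hI2 : k ∈ I (m + 1) := by
      rw [hI, Finset.mem_Icc, Pi.le_def, Pi.le_def, ← forall_and]
      intro l
      rw [← abs_le]
      have h1 : ‖k l‖ ≤ ‖k‖ := norm_le_pi_norm k l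
      rw [Int.norm_eq_abs] at h1
      have h2 : ((|k l| : ℤ) : ℝ) < ((m + 2 : ℤ) : ℝ) := by
        push_cast
        linarith
      have h3 : |k l| < m + 2 := by exact_mod_cast h2
      push_cast
      omega
    exact ⟨hI2, fun h => by linarith [(hmem _ _).1 h]⟩
  have hcard : ((I (m + 1) \ I m).card : ℤ) ≤ 2 * d * (3 * (m + 1)) ^ (d - 1) := by
    rw [Finset.card_sdiff_of_subset hsub, Nat.cast_sub (Finset.card_le_card hsub), hIcard, hIcard]
    have h := (le_abs_self _).trans
      (abs_pow_sub_pow_le (2 * ((m + 1 : ℕ) : ℤ) + 1) (2 * (m : ℤ) + 1) d)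
    push_cast at h ⊢
    refine h.trans ?_
    have h1 : |2 * ((m : ℤ) + 1) + 1 - (2 * m + 1)| = 2 := by
      rw [show 2 * ((m : ℤ) + 1) + 1 - (2 * m + 1) = 2 by ring]
      rfl
    have h2 : max |2 * ((m : ℤ) + 1) + 1| |2 * (m : ℤ) + 1| ≤ 3 * (m + 1) := by
      rw [abs_of_nonneg (by positivity), abs_of_nonneg (by positivity)]
      omega
    rw [h1]
    gcongr
  calc ENat.card {k : Fin d → ℤ // ⌊‖k‖⌋₊ = m + 1}
      = Set.encard {k : Fin d → ℤ | ⌊‖k‖⌋₊ = m + 1} := rfl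
    _ ≤ Set.encard ((I (m + 1) \ I m : Finset _) : Set _) := Set.encard_le_encard hfib
    _ = ((I (m + 1) \ I m).card : ℕ) := Set.encard_coe_eq_coe_finsetCard _
    _ ≤ _ := by exact_mod_cast hcard

theorem tsum_comp_floor_norm (g : ℕ → ℝ≥0∞) :
    ∑' k : Fin d → ℤ, g ⌊‖k‖⌋₊
      = ∑' m, (ENat.card {k : Fin d → ℤ // ⌊‖k‖⌋₊ = m} : ℝ≥0∞) * g m := by
  rw [← (Equiv.sigmaFiberEquiv fun k : Fin d → ℤ => ⌊‖k‖⌋₊).tsum_eq, ENNReal.tsum_sigma']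
  refine tsum_congr fun m => ?_
  rw [← ENNReal.tsum_const]
  exact tsum_congr fun k => congrArg g k.2

theorem encard_floor_norm_add_le (hd : 0 < d) (n N : ℕ) :
    (ENat.card {k : Fin d → ℤ // ⌊‖k‖⌋₊ = n + (N + 1)} : ℝ≥0∞)
      ≤ (2 * d * (3 * (N + 1)) ^ (d - 1) : ℕ) * ((n + 1 : ℕ) : ℝ≥0∞) ^ (d - 1) := by
  have h := encard_floor_norm_le hd (m := n + (N + 1)) (by omega)
  have h' : 2 * d * (3 * (n + (N + 1))) ^ (d - 1)
      ≤ 2 * d * (3 * (N + 1)) ^ (d - 1) * (n + 1) ^ (d - 1) := by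
    rw [mul_assoc (2 * d), ← mul_pow]
    have : 3 * (n + (N + 1)) ≤ 3 * (N + 1) * (n + 1) := by nlinarith
    exact Nat.mul_le_mul_left _ (Nat.pow_le_pow_left this _)
  calc (ENat.card {k : Fin d → ℤ // ⌊‖k‖⌋₊ = n + (N + 1)} : ℝ≥0∞)
      ≤ (((2 * d * (3 * (n + (N + 1))) ^ (d - 1) : ℕ) : ℕ∞) : ℝ≥0∞) := ENat.toENNReal_mono h
    _ = ((2 * d * (3 * (n + (N + 1))) ^ (d - 1) : ℕ) : ℝ≥0∞) := ENat.toENNReal_coe _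
    _ ≤ ((2 * d * (3 * (N + 1)) ^ (d - 1) * (n + 1) ^ (d - 1) : ℕ) : ℝ≥0∞) :=
        Nat.cast_le.2 h'
    _ = _ := by rw [Nat.cast_mul, Nat.cast_pow (n + 1)]

/-- Delaying the variations by `N` costs only a constant factor depending on `N` and `d`, since n +
N + 1 ≤ (N + 1)(n + 1). -/
theorem tsum_norm_ne_top (hd : 0 < d) {δ : ℕ → ℝ≥0∞}
    (hδ : ∑' n : ℕ, ((n + 1 : ℕ) : ℝ≥0∞) ^ (d - 1) * δ (n + 1) < ∞) (N : ℕ) :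
    ∑' k : Fin d → ℤ, (if ⌊‖k‖⌋₊ ≤ N then 0 else δ (⌊‖k‖⌋₊ - N)) ≠ ∞ := by
  have hsplit : ∀ u : ℕ → ℝ≥0∞, ∑ m ∈ Finset.range (N + 1), u m + ∑' n, u (n + (N + 1)) =
      ∑' m, u m := fun u => ENNReal.summable.sum_add_tsum_nat_add'
  rw [tsum_comp_floor_norm fun m => if m ≤ N then 0 else δ (m - N), ← hsplit,
    Finset.sum_eq_zero, zero_add]
  · have h : ∀ n, (ENat.card {k : Fin d → ℤ // ⌊‖k‖⌋₊ = n + (N + 1)} : ℝ≥0∞) *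
        (if n + (N + 1) ≤ N then 0 else δ (n + (N + 1) - N))
        ≤ (2 * d * (3 * (N + 1)) ^ (d - 1) : ℕ) *
          (((n + 1 : ℕ) : ℝ≥0∞) ^ (d - 1) * δ (n + 1)) := fun n => by
      rw [if_neg (by omega), show n + (N + 1) - N = n + 1 by omega, ← mul_assoc]
      gcongr
      exact encard_floor_norm_add_le hd n N
    refine ne_top_of_le_ne_top ?_ (ENNReal.tsum_le_tsum h)
    rw [ENNReal.tsum_mul_left]
    exact ENNReal.mul_ne_top (ENNReal.natCast_ne_top _) hδ.ne
  · intro m hm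
    rw [if_pos (Nat.lt_succ_iff.1 (Finset.mem_range.1 hm)), mul_zero]

end Lattice

/-! ### Functions with summable variation -/

section Variation

variable {d : ℕ} {A : Type*} [TopologicalSpace A] {X : Subshift d A} {f : X → ℝ}

theorem HasSummableVariation.variation_ne_top (hf : HasSummableVariation f) {n : ℕ} (hn : 0 < n) :
    variation f n ≠ ∞ := by
  obtain ⟨n, rfl⟩ : ∃ j, n = j + 1 := ⟨n - 1, by omega⟩
  refine ne_top_of_le_ne_top (ENNReal.ne_top_of_tsum_ne_top hf.ne n) ?_
  exact le_mul_of_one_le_left zero_le (one_le_pow₀ (by simp))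

theorem abs_sub_le_variation {n : ℕ} (h : variation f n ≠ ∞) {x y : X}
    (hxy : AgreeOn (box d n) x.1 y.1) : |f x - f y| ≤ (variation f n).toReal := by
  rw [← ENNReal.ofReal_le_iff_le_toReal h]
  exact le_iSup_of_le x (le_iSup_of_le y (le_iSup_of_le hxy le_rfl))

theorem isOpen_setOf_agreeOn [DiscreteTopology A] {S : Set (Fin d → ℤ)} (hS : S.Finite)
    (x : Config d A) : IsOpen {y : Config d A | AgreeOn S y x} := by
  have : {y : Config d A | AgreeOn S y x} = ⋂ i ∈ S, {y | y i = x i} := by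
    ext y
    simp [AgreeOn]
  rw [this]
  exact hS.isOpen_biInter fun i _ => (isOpen_discrete {x i}).preimage
    (continuous_apply i : Continuous fun y : Config d A => y i)

theorem HasSummableVariation.continuous [DiscreteTopology A] (hf : HasSummableVariation f) :
    Continuous f := by
  rw [Metric.continuous_iff']
  intro x ε hε
  have ht := ENNReal.tendsto_atTop_zero_of_tsum_ne_top hf.ne
  obtain ⟨n, hn⟩ := (ht.eventually (gt_mem_nhds (ENNReal.ofReal_pos.2 hε))).exists
  have hv : variation f (n + 1) < ENNReal.ofReal ε :=
    lt_of_le_of_lt (le_mul_of_one_le_left zero_le (one_le_pow₀ (by simp))) hn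
  have hopen : IsOpen {y : X | AgreeOn (box d (n + 1)) y.1 x.1} :=
    (isOpen_setOf_agreeOn (finite_box d (n + 1)) x.1).preimage continuous_subtype_val
  filter_upwards [hopen.mem_nhds fun _ _ => rfl] with y hy
  rw [Real.dist_eq]
  exact (abs_sub_le_variation (hf.variation_ne_top n.succ_pos) hy).trans_lt
    ((ENNReal.lt_ofReal_iff_toReal_lt hv.ne_top).1 hv)

instance compactSpace_subshift [Finite A] : CompactSpace X :=
  isCompact_iff_compactSpace.1 X.isClosed.isCompact

theorem HasSummableVariation.exists_summable_bound [Finite A] [DiscreteTopology A] (hd : 0 < d)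
    (hf : HasSummableVariation f) (N : ℕ) :
    ∃ u : (Fin d → ℤ) → ℝ, Summable u ∧ ∀ x y : X,
      (∀ i : Fin d → ℤ, (N : ℝ) ≤ ‖i‖ → x.1 i = y.1 i) →
      ∀ k, |f (shift k y) - f (shift k x)| ≤ u k := by
  obtain ⟨M, hM⟩ := isCompact_univ.exists_bound_of_continuousOn hf.continuous.continuousOn
  have hM' : ∀ x : X, |f x| ≤ M := fun x => hM x (Set.mem_univ x)
  -- Near the origin only boundedness of f is available. Further out, ‖i‖ < ⌊‖k‖⌋ - N forces ‖i + k‖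
  -- ≥ N, where the two points agree.
  refine ⟨fun k => (if ⌊‖k‖⌋₊ ≤ N then 2 * M else 0) +
    (if ⌊‖k‖⌋₊ ≤ N then 0 else variation f (⌊‖k‖⌋₊ - N)).toReal, ?_, ?_⟩
  · refine Summable.add ?_ (ENNReal.summable_toReal (tsum_norm_ne_top hd hf N))
    refine summable_of_hasFiniteSupport ((finite_setOf_norm_le d (N + 1)).subset fun k hk => ?_)
    have hk' : ⌊‖k‖⌋₊ ≤ N := by
      by_contra h
      exact hk (if_neg h)
    have h1 := Nat.lt_floor_add_one ‖k‖
    have h2 : (⌊‖k‖⌋₊ : ℝ) ≤ N := by exact_mod_cast hk'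
    simp only [Set.mem_ofPred_eq]
    push_cast
    linarith
  · intro x y hxy k
    by_cases hk : ⌊‖k‖⌋₊ ≤ N
    · simp only [hk, if_true, ENNReal.toReal_zero, add_zero]
      have := abs_sub (f (shift k y)) (f (shift k x))
      linarith [hM' (shift k y), hM' (shift k x)]
    · simp only [hk, if_false, zero_add]
      refine abs_sub_le_variation (hf.variation_ne_top (by omega)) fun i hi => ?_
      refine (hxy (i + k) ?_).symm
      have h1 := Nat.floor_le (norm_nonneg k)
      have h2 : ‖i‖ < ((⌊‖k‖⌋₊ - N : ℕ) : ℝ) := hi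
      rw [Nat.cast_sub (by omega)] at h2
      have h3 : ‖k‖ ≤ ‖i + k‖ + ‖i‖ := by
        simpa using norm_sub_le (i + k) i
      linarith

theorem exists_agree_of_mem_gibbsRel {x y : X} (h : (x, y) ∈ gibbsRel X) :
    ∃ N : ℕ, ∀ i : Fin d → ℤ, (N : ℝ) ≤ ‖i‖ → x.1 i = y.1 i := by
  obtain ⟨Λ, hΛ⟩ := h
  obtain ⟨N, hN⟩ := exists_nat_le_norm_notMem Λ
  exact ⟨N, fun i hi => hΛ i (hN i hi)⟩

theorem HasSummableVariation.summable_cocycle [Finite A] [DiscreteTopology A] (hd : 0 < d)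
    (hf : HasSummableVariation f) {x y : X} (h : (x, y) ∈ gibbsRel X) :
    Summable fun k : Fin d → ℤ => f (shift k y) - f (shift k x) := by
  obtain ⟨N, hN⟩ := exists_agree_of_mem_gibbsRel h
  obtain ⟨u, hu, hb⟩ := hf.exists_summable_bound hd N
  exact hu.of_norm_bounded fun k => hb x y hN k

theorem HasSummableVariation.cocycle_add [Finite A] [DiscreteTopology A] (hd : 0 < d)
    (hf : HasSummableVariation f) {x y z : X} (hxy : (x, y) ∈ gibbsRel X)
    (hyz : (y, z) ∈ gibbsRel X) : cocycle f x z = cocycle f x y + cocycle f y z := by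
  rw [cocycle, cocycle, cocycle,
    ← (hf.summable_cocycle hd hxy).tsum_add (hf.summable_cocycle hd hyz)]
  exact tsum_congr fun k => by ring

theorem continuous_shift (k : Fin d → ℤ) : Continuous (shift k : X → X) :=
  Continuous.subtype_mk
    (continuous_pi fun i =>
      (continuous_apply (i + k) : Continuous fun y : Config d A => y (i + k)).comp
        continuous_subtype_val) _

theorem HasSummableVariation.continuous_cocycle [Finite A] [DiscreteTopology A] (hd : 0 < d)
    (hf : HasSummableVariation f) {Z : Type*} [TopologicalSpace Z] {u v : Z → X}
    (hu : Continuous u) (hv : Continuous v) {N : ℕ}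
    (h : ∀ z, ∀ i : Fin d → ℤ, (N : ℝ) ≤ ‖i‖ → (u z).1 i = (v z).1 i) :
    Continuous fun z => cocycle f (u z) (v z) := by
  obtain ⟨b, hb, hle⟩ := hf.exists_summable_bound hd N
  exact continuous_tsum (fun k => (hf.continuous.comp ((continuous_shift k).comp hv)).sub
    (hf.continuous.comp ((continuous_shift k).comp hu))) hb fun k z => hle _ _ (h z) k

end Variation

/-! ### The metric of the full shift -/

section Metric

variable {d : ℕ} {A : Type*}

theorem apply_zero_eq_of_rho_lt_one {x y : Config d A} (h : rho x y < 1) : x 0 = y 0 := by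
  by_contra hne
  have hxy : x ≠ y := fun h => hne (congrFun h 0)
  have hS : {n : ℕ | AgreeOn (box d n) x y} ⊆ {0} := by
    intro n hn
    by_contra hn0
    have : (0 : Fin d → ℤ) ∈ box d n := by
      have : (0 : ℝ) < n := by exact_mod_cast Nat.pos_of_ne_zero hn0
      simpa [box] using this
    exact hne (hn 0 this)
  have h0 : sSup {n : ℕ | AgreeOn (box d n) x y} = 0 := by
    have := csSup_le' (s := {n : ℕ | AgreeOn (box d n) x y}) (a := 0) fun n hn => (hS hn).le
    exact Nat.le_zero.1 this
  rw [rho, if_neg hxy, h0] at h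
  norm_num at h

theorem rho_le_of_agreeOn {x y : Config d A} {n : ℕ} (h : AgreeOn (box d n) x y) :
    rho x y ≤ (1 / 2) ^ n := by
  rw [rho]
  split_ifs with hxy
  · positivity
  obtain ⟨i, hi⟩ := Function.ne_iff.1 hxy
  -- The supremum of an unbounded set of naturals defaults to 0, so boundedness is essential.
  have hbdd : BddAbove {n : ℕ | AgreeOn (box d n) x y} := by
    refine ⟨⌈‖i‖⌉₊, fun m hm => ?_⟩
    by_contra hlt
    exact hi (hm i (show ‖i‖ < m from Nat.lt_of_ceil_lt (not_le.1 hlt)))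
  rw [one_div, inv_pow]
  have := le_csSup hbdd h
  gcongr
  norm_num

end Metric

/-! ### Conjugating homeomorphisms and the Gibbs relation -/

section Conjugating

variable {d : ℕ} {A : Type*} [TopologicalSpace A] {X : Subshift d A}

/-- Taking ε = 1 suffices: ρ < 1 forces equality at the origin, and the origin of σ^k x is the site
k of x. -/
theorem isConjugating_iff {O : Opens X} {φ : O → X} :
    IsConjugating φ ↔
      ∃ N : ℕ, ∀ (x : O) (i : Fin d → ℤ), (N : ℝ) ≤ ‖i‖ → x.1.1 i = (φ x).1 i := by
  constructor
  · intro h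
    obtain ⟨N, hN⟩ := h 1 one_pos
    obtain ⟨M, hM⟩ := exists_nat_ge N
    refine ⟨M, fun x i hi => ?_⟩
    have := apply_zero_eq_of_rho_lt_one (hN i (hM.trans hi) x)
    simpa [shift, fullShift] using this
  · rintro ⟨N, hN⟩ ε hε
    obtain ⟨n, hn⟩ := exists_pow_lt_of_lt_one hε (by norm_num : (1 / 2 : ℝ) < 1)
    refine ⟨N + n, fun k hk x => (rho_le_of_agreeOn fun i hi => ?_).trans_lt hn⟩
    refine hN x (i + k) ?_
    have h1 : ‖i‖ < n := hi
    have h2 : ‖k‖ ≤ ‖i + k‖ + ‖i‖ := by simpa using norm_sub_le (i + k) i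
    linarith

theorem mem_gibbsRel_of_agree {x y : X} {N : ℕ}
    (h : ∀ i : Fin d → ℤ, (N : ℝ) ≤ ‖i‖ → x.1 i = y.1 i) : (x, y) ∈ gibbsRel X := by
  refine ⟨(finite_box d N).toFinset, fun i hi => h i (not_lt.1 fun hlt => hi ?_)⟩
  rw [Set.Finite.coe_toFinset]
  exact hlt

theorem gibbsRel_symm {x y : X} (h : (x, y) ∈ gibbsRel X) : (y, x) ∈ gibbsRel X := by
  obtain ⟨N, hN⟩ := exists_agree_of_mem_gibbsRel h
  exact mem_gibbsRel_of_agree fun i hi => (hN i hi).symm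

theorem ConjHomeo.mem_gibbsRel (p : ConjHomeo X) (x : p.dom) : (x.1, p.toFun x) ∈ gibbsRel X := by
  obtain ⟨N, hN⟩ := isConjugating_iff.1 p.isConjugating
  exact mem_gibbsRel_of_agree (hN x)

theorem ConjHomeo.continuous_cocycle [Finite A] [DiscreteTopology A] (hd : 0 < d) {f : X → ℝ}
    (hf : HasSummableVariation f) (p : ConjHomeo X) :
    Continuous fun x : p.dom => cocycle f x.1 (p.toFun x) := by
  obtain ⟨N, hN⟩ := isConjugating_iff.1 p.isConjugating
  exact hf.continuous_cocycle hd continuous_subtype_val p.isEmbedding.continuous hN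

theorem isFamilyOfMultipliers_gibbsMultiplier [Finite A] [DiscreteTopology A] (hd : 0 < d)
    {f : X → ℝ} (hf : HasSummableVariation f) : IsFamilyOfMultipliers (gibbsMultiplier f) where
  pos p x := Real.exp_pos _
  continuous p := Real.continuous_exp.comp (p.continuous_cocycle hd hf)
  restrict p p' h hφ x := by rw [gibbsMultiplier, gibbsMultiplier, hφ x]
  comp p p' p'' h h' hφ x := by
    rw [gibbsMultiplier, gibbsMultiplier, gibbsMultiplier, ← Real.exp_add, hφ x,
      hf.cocycle_add hd (p'.mem_gibbsRel ⟨x, h x.2⟩) (p''.mem_gibbsRel ⟨_, h' x⟩)]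

/-- The map of the domain of `p` to the graph of `p`, a subset of the Gibbs relation. -/
def ConjHomeo.graph (p : ConjHomeo X) (x : p.dom) : gibbsRel X :=
  ⟨(x.1, p.toFun x), p.mem_gibbsRel x⟩

end Conjugating

/-! ### Exchanging finite patterns -/

section Exchange

variable {d : ℕ} {A : Type*} [TopologicalSpace A] {X : Subshift d A}

/-- The configuration that carries the pattern `b` on `Λ` and agrees with `x` elsewhere. -/
def overwrite (Λ : Finset (Fin d → ℤ)) (b : Λ → A) (x : Config d A) : Config d A :=
  fun i => if h : i ∈ Λ then b ⟨i, h⟩ else x i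

theorem continuous_overwrite (Λ : Finset (Fin d → ℤ)) (b : Λ → A) :
    Continuous (overwrite Λ b) := by
  refine continuous_pi fun i => ?_
  by_cases h : i ∈ Λ
  · simp only [overwrite, h, dite_true]
    exact continuous_const
  · simp only [overwrite, h, dite_false]
    exact continuous_apply i

variable (X) in
/-- Pairs of patterns `a`, `b` on a finite set of sites such that `a` may be replaced by `b` wherever
it occurs at this place in a point of `X`. -/
def Exchange : Type _ :=
  {s : Σ Λ : Finset (Fin d → ℤ), (Λ → A) × (Λ → A) //
    ∀ x ∈ X.carrier, (∀ i : s.1, x i = s.2.1 i) → overwrite s.1 s.2.2 x ∈ X.carrier}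

instance [Finite A] : Countable (Exchange X) := inferInstanceAs (Countable (Subtype _))

instance : Nonempty (Exchange X) :=
  ⟨⟨⟨∅, fun i => absurd i.2 (Finset.notMem_empty _), fun i => absurd i.2 (Finset.notMem_empty _)⟩,
    fun x hx _ => by
      convert hx using 1
      ext i
      simp [overwrite]⟩⟩

/-- The set of points of `X` in which the first pattern of `s` occurs. -/
def Exchange.cylinder (s : Exchange X) : Set X := {x | ∀ i : s.1.1, x.1 i = s.1.2.1 i}

theorem Exchange.isClopen_cylinder [DiscreteTopology A] (s : Exchange X) :
    IsClopen s.cylinder := by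
  have : s.cylinder = ⋂ i : s.1.1, (fun x : X => x.1 i) ⁻¹' {s.1.2.1 i} := by
    ext x
    simp [Exchange.cylinder]
  rw [this]
  exact isClopen_iInter_of_finite fun i => (isClopen_discrete _).preimage
    ((continuous_apply i.1 : Continuous fun y : Config d A => y i.1).comp continuous_subtype_val)

/-- The map that replaces the first pattern of `s` by the second one. -/
def Exchange.map (s : Exchange X) (x : s.cylinder) : X :=
  ⟨overwrite s.1.1 s.1.2.2 x.1.1, s.2 x.1.1 x.1.2 x.2⟩

/-- The conjugating homeomorphism that replaces the first pattern of `s` by the second one. -/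
def Exchange.conjHomeo [Finite A] [DiscreteTopology A] (s : Exchange X) : ConjHomeo X where
  dom := ⟨s.cylinder, s.isClopen_cylinder.isOpen⟩
  toFun := s.map
  isEmbedding := by
    have : CompactSpace s.cylinder :=
      isCompact_iff_compactSpace.1 s.isClopen_cylinder.isClosed.isCompact
    have hc : Continuous s.map := Continuous.subtype_mk
      ((continuous_overwrite _ _).comp (continuous_subtype_val.comp continuous_subtype_val)) _
    -- Nothing is lost by overwriting, as all points of the cylinder carry the same first pattern;
    -- compactness does the rest.
    refine (hc.isClosedEmbedding fun x y hxy => ?_).isEmbedding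
    ext i
    by_cases h : i ∈ s.1.1
    · exact (x.2 ⟨i, h⟩).trans (y.2 ⟨i, h⟩).symm
    · have := congrFun (congrArg Subtype.val hxy) i
      simpa [Exchange.map, overwrite, h] using this
  isConjugating := by
    obtain ⟨N, hN⟩ := exists_nat_le_norm_notMem s.1.1
    refine isConjugating_iff.2 ⟨N, fun x i hi => ?_⟩
    simp [Exchange.map, overwrite, hN i hi]

/-- In a subshift of finite type every pair in the Gibbs relation lies in the graph of an exchange
of patterns. -/
theorem Subshift.IsSFT.exists_exchange [Finite A] [DiscreteTopology A] (hX : X.IsSFT)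
    (q : gibbsRel X) : ∃ s : Exchange X, q ∈ Set.range s.conjHomeo.graph := by
  classical
  obtain ⟨F, hF, hXF⟩ := hX
  obtain ⟨⟨x, y⟩, Λ₀, h₀⟩ := q
  have h₀' : ∀ i, i ∉ Λ₀ → x.1 i = y.1 i := fun i hi => h₀ i hi
  -- `D` collects the differences of sites within one forbidden pattern. Thickening `Λ₀` by it makes
  -- Λ contain every translate of a forbidden support that meets `Λ₀`.
  set D : Finset (Fin d → ℤ) := hF.toFinset.biUnion fun s => Finset.image₂ (· - ·) s.1 s.1
  set Λ : Finset (Fin d → ℤ) := Λ₀ ∪ Finset.image₂ (· + ·) Λ₀ D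
  have hgood : ∀ z ∈ X.carrier, (∀ i : Λ, z i = x.1 i) →
      overwrite Λ (fun i => y.1 i) z ∈ X.carrier := by
    intro z hz hzx
    have hin : ∀ i ∈ Λ, overwrite Λ (fun i => y.1 i) z i = y.1 i := fun i hi => by
      simp [overwrite, hi]
    have hout : ∀ i ∉ Λ₀, overwrite Λ (fun i => y.1 i) z i = z i := fun i hi => by
      by_cases hiΛ : i ∈ Λ
      · rw [hin i hiΛ, ← h₀' i hi]
        exact (hzx ⟨i, hiΛ⟩).symm
      · simp [overwrite, hiΛ]
    have hy : y.1 ∈ avoiding F := hXF ▸ y.2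
    rw [hXF] at hz
    refine hXF.ge ?_
    intro j M hM
    -- A forbidden pattern meeting `Λ₀` would lie inside Λ and hence occur in y; one missing `Λ₀`
    -- would already occur in z.
    by_cases hj : ∃ i₀ ∈ M, i₀ + j ∈ Λ₀
    · obtain ⟨i₀, hi₀, hi₀j⟩ := hj
      refine hy j M ?_
      convert hM using 3 with i
      refine (hin (i + j) (Finset.mem_union_right _ (Finset.mem_image₂.2
        ⟨i₀ + j, hi₀j, i - i₀, ?_, by abel⟩))).symm
      exact Finset.mem_biUnion.2 ⟨_, hF.mem_toFinset.2 hM,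
        Finset.mem_image₂.2 ⟨i, i.2, i₀, hi₀, rfl⟩⟩
    · push Not at hj
      refine hz j M ?_
      convert hM using 3 with i
      exact (hout (i + j) (hj i i.2)).symm
  refine ⟨⟨⟨Λ, fun i => x.1 i, fun i => y.1 i⟩, hgood⟩, ⟨x, fun i => rfl⟩, ?_⟩
  refine Subtype.ext (Prod.ext rfl (Subtype.ext (funext fun i => ?_)))
  change overwrite Λ (fun i => y.1 i) x.1 i = y.1 i
  by_cases h : i ∈ Λ
  · simp [overwrite, h]
  · simp only [overwrite, h, dite_false]
    exact h₀' i fun h' => h (Finset.mem_union_left _ h')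

/-- Countably many conjugating homeomorphisms whose graphs cover the Gibbs relation. -/
theorem Subshift.IsSFT.exists_cover [Finite A] [DiscreteTopology A] (hX : X.IsSFT) :
    ∃ p : ℕ → ConjHomeo X, ⋃ n, Set.range (p n).graph = Set.univ := by
  obtain ⟨e, he⟩ := exists_surjective_nat (Exchange X)
  refine ⟨fun n => (e n).conjHomeo, Set.eq_univ_of_forall fun q => ?_⟩
  obtain ⟨s, hs⟩ := hX.exists_exchange q
  obtain ⟨n, rfl⟩ := he s
  exact Set.mem_iUnion.2 ⟨n, hs⟩

end Exchange

/-! ### Gibbs measures and Gibbs states -/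

section Main

variable {d : ℕ} {A : Type*} [Finite A] [TopologicalSpace A] [DiscreteTopology A]
  [MeasurableSpace A] [BorelSpace A] {X : Subshift d A} {f : X → ℝ}

instance polishSpace_subshift : PolishSpace X := by
  have : Countable A := Finite.to_countable
  have : PolishSpace A := inferInstance
  have : PolishSpace (Config d A) := inferInstance
  exact X.isClosed.polishSpace

instance (p : ConjHomeo X) : PolishSpace p.dom := p.dom.isOpen.polishSpace

/-- Lusin-Souslin: a continuous injection of a Polish space has Borel images of Borel sets. -/
theorem ConjHomeo.measurableEmbedding (p : ConjHomeo X) : MeasurableEmbedding p.toFun :=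
  p.isEmbedding.continuous.measurableEmbedding p.isEmbedding.injective

theorem ConjHomeo.measurableEmbedding_coe (p : ConjHomeo X) :
    MeasurableEmbedding (Subtype.val : p.dom → X) :=
  MeasurableEmbedding.subtype_coe p.dom.isOpen.measurableSet

theorem ConjHomeo.measurableEmbedding_graph (p : ConjHomeo X) : MeasurableEmbedding p.graph := by
  refine Continuous.measurableEmbedding ?_ fun x y h => ?_
  · exact (continuous_subtype_val.prodMk p.isEmbedding.continuous).subtype_mk _
  · exact Subtype.ext (congrArg (fun q : gibbsRel X => q.1.1) h)

theorem HasSummableVariation.measurable_cocycle (hd : 0 < d) (hf : HasSummableVariation f) :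
    Measurable fun q : gibbsRel X => cocycle f q.1.1 q.1.2 := by
  refine measurable_of_tendsto_metrizable' Filter.atTop
    (f := fun (s : Finset (Fin d → ℤ)) (q : gibbsRel X) =>
      ∑ k ∈ s, (f (shift k q.1.2) - f (shift k q.1.1))) (fun s => ?_)
    (tendsto_pi_nhds.2 fun q => (hf.summable_cocycle hd q.2).hasSum)
  have hm : ∀ k : Fin d → ℤ, Measurable fun x : X => f (shift k x) := fun k =>
    (hf.continuous.comp (continuous_shift k)).measurable
  exact Finset.measurable_fun_sum s fun k _ =>
    ((hm k).comp (measurable_snd.comp measurable_subtype_coe)).sub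
      ((hm k).comp (measurable_fst.comp measurable_subtype_coe))

theorem isGibbsState_gibbsMultiplier_iff {μ : Measure X} :
    IsGibbsState (gibbsMultiplier f) μ ↔ ∀ p : ConjHomeo X,
      (μ.comap (Subtype.val : p.dom → X)).withDensity
        (fun x => ENNReal.ofReal (Real.exp (cocycle f x.1 (p.toFun x)))) = μ.comap p.toFun := by
  refine forall_congr' fun p => ?_
  rw [← p.measurableEmbedding.map_comap]
  constructor
  · intro h
    rw [← p.measurableEmbedding.comap_map (Measure.withDensity _ _),
      ← p.measurableEmbedding.comap_map (μ.comap p.toFun)]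
    exact congrArg (Measure.comap p.toFun) h
  · intro h
    exact congrArg (Measure.map p.toFun) h

theorem QuasiInvariant.comap_coe_absolutelyContinuous {μ : Measure X}
    (h : QuasiInvariant (gibbsRel X) μ) (p : ConjHomeo X) :
    μ.comap (Subtype.val : p.dom → X) ≪ μ.comap p.toFun := by
  refine Measure.AbsolutelyContinuous.mk fun S hS h0 => ?_
  rw [p.measurableEmbedding.comap_apply] at h0
  rw [p.measurableEmbedding_coe.comap_apply]
  refine measure_mono_null ?_ (h _ (p.measurableEmbedding.measurableSet_image.2 hS) h0)
  rintro _ ⟨x, hx, rfl⟩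
  exact ⟨p.toFun x, Set.mem_image_of_mem _ hx, gibbsRel_symm (p.mem_gibbsRel x)⟩

theorem QuasiInvariant.comap_absolutelyContinuous {μ : Measure X}
    (h : QuasiInvariant (gibbsRel X) μ) (p : ConjHomeo X) :
    μ.comap p.toFun ≪ μ.comap (Subtype.val : p.dom → X) := by
  refine Measure.AbsolutelyContinuous.mk fun S hS h0 => ?_
  rw [p.measurableEmbedding_coe.comap_apply] at h0
  rw [p.measurableEmbedding.comap_apply]
  refine measure_mono_null ?_ (h _ (p.measurableEmbedding_coe.measurableSet_image.2 hS) h0)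
  rintro _ ⟨x, hx, rfl⟩
  exact ⟨x.1, Set.mem_image_of_mem _ hx, p.mem_gibbsRel x⟩

theorem isCountableToOne_fst {p : ℕ → ConjHomeo X}
    (hp : ⋃ n, Set.range (p n).graph = Set.univ) :
    IsCountableToOne (fun q : gibbsRel X => q.1.1) fun n => Set.range (p n).graph :=
  isCountableToOne_range (measurable_fst.comp measurable_subtype_coe)
    (fun n => (p n).measurableEmbedding_graph) (fun n => (p n).measurableEmbedding_coe) hp

theorem isCountableToOne_snd {p : ℕ → ConjHomeo X}
    (hp : ⋃ n, Set.range (p n).graph = Set.univ) :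
    IsCountableToOne (fun q : gibbsRel X => q.1.2) fun n => Set.range (p n).graph :=
  isCountableToOne_range (measurable_snd.comp measurable_subtype_coe)
    (fun n => (p n).measurableEmbedding_graph) (fun n => (p n).measurableEmbedding) hp

theorem comap_graph_leftCounting (hX : X.IsSFT) (μ : Measure X) (p : ConjHomeo X) :
    (leftCounting (gibbsRel X) μ).comap p.graph = μ.comap (Subtype.val : p.dom → X) := by
  obtain ⟨e, he⟩ := hX.exists_cover
  exact (isCountableToOne_fst he).comap_fiberCounting μ p.measurableEmbedding_graph
    p.measurableEmbedding_coe

theorem comap_graph_rightCounting (hX : X.IsSFT) (μ : Measure X) (p : ConjHomeo X) :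
    (rightCounting (gibbsRel X) μ).comap p.graph = μ.comap p.toFun := by
  obtain ⟨e, he⟩ := hX.exists_cover
  exact (isCountableToOne_snd he).comap_fiberCounting μ p.measurableEmbedding_graph
    p.measurableEmbedding

theorem sigmaFinite_leftCounting (hX : X.IsSFT) (μ : Measure X) [IsFiniteMeasure μ] :
    SigmaFinite (leftCounting (gibbsRel X) μ) := by
  obtain ⟨e, he⟩ := hX.exists_cover
  exact (isCountableToOne_fst he).sigmaFinite_fiberCounting μ

theorem sigmaFinite_rightCounting (hX : X.IsSFT) (μ : Measure X) [IsFiniteMeasure μ] :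
    SigmaFinite (rightCounting (gibbsRel X) μ) := by
  obtain ⟨e, he⟩ := hX.exists_cover
  exact (isCountableToOne_snd he).sigmaFinite_fiberCounting μ

/-- A measure is a Gibbs state if and only if its left counting measure has density `e^{-c_f}` with
respect to the right one. -/
theorem isGibbsState_iff_leftCounting_eq (hd : 0 < d) (hX : X.IsSFT)
    (hf : HasSummableVariation f) (μ : Measure X) :
    IsGibbsState (gibbsMultiplier f) μ ↔ leftCounting (gibbsRel X) μ =
      (rightCounting (gibbsRel X) μ).withDensity
        fun q => ENNReal.ofReal (Real.exp (-cocycle f q.1.1 q.1.2)) := by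
  have key : ∀ p : ConjHomeo X,
      (leftCounting (gibbsRel X) μ).comap p.graph = ((rightCounting (gibbsRel X) μ).withDensity
        fun q => ENNReal.ofReal (Real.exp (-cocycle f q.1.1 q.1.2))).comap p.graph ↔
      (μ.comap (Subtype.val : p.dom → X)).withDensity
        (fun x => ENNReal.ofReal (Real.exp (cocycle f x.1 (p.toFun x)))) = μ.comap p.toFun := by
    intro p
    rw [p.measurableEmbedding_graph.comap_withDensity, comap_graph_leftCounting hX,
      comap_graph_rightCounting hX]
    exact withDensity_exp_neg_iff (p.continuous_cocycle hd hf).measurable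
  rw [isGibbsState_gibbsMultiplier_iff]
  constructor
  · intro h
    obtain ⟨e, he⟩ := hX.exists_cover
    exact measure_eq_of_comap_eq (fun n => (e n).measurableEmbedding_graph) he
      fun n => (key (e n)).2 (h (e n))
  · intro h p
    exact (key p).1 (congrArg (Measure.comap p.graph) h)

/-- The saturation of S is covered by the countably many images of S under the maps of the cover,
and each image is null because φ^*μ has a density with respect to μ on O. -/
theorem IsGibbsState.quasiInvariant (hX : X.IsSFT) {μ : Measure X}
    (h : IsGibbsState (gibbsMultiplier f) μ) : QuasiInvariant (gibbsRel X) μ := by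
  intro S hS h0
  obtain ⟨e, he⟩ := hX.exists_cover
  have hsub : saturation (gibbsRel X) S ⊆ ⋃ n, (e n).toFun '' (Subtype.val ⁻¹' S) := by
    rintro y ⟨x, hx, hxy⟩
    obtain ⟨n, z, hz⟩ := Set.mem_iUnion.1 (he ▸ Set.mem_univ (⟨(x, y), hxy⟩ : gibbsRel X))
    have h1 : z.1 = x := congrArg (fun q : gibbsRel X => q.1.1) hz
    have h2 : (e n).toFun z = y := congrArg (fun q : gibbsRel X => q.1.2) hz
    refine Set.mem_iUnion.2 ⟨n, z, ?_, h2⟩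
    rw [Set.mem_preimage, h1]
    exact hx
  refine measure_mono_null hsub (measure_iUnion_null fun n => ?_)
  rw [← (e n).measurableEmbedding.comap_apply, ← isGibbsState_gibbsMultiplier_iff.1 h (e n)]
  refine withDensity_absolutelyContinuous _ _ ?_
  rw [(e n).measurableEmbedding_coe.comap_apply]
  exact measure_mono_null (Set.image_preimage_subset _ _) h0

theorem isGibbsMeasure_iff_isGibbsState (hd : 0 < d) (hX : X.IsSFT)
    (hf : HasSummableVariation f) (μ : Measure X) [IsFiniteMeasure μ] :
    IsGibbsMeasure f μ ↔ IsGibbsState (gibbsMultiplier f) μ := by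
  have := sigmaFinite_leftCounting hX μ
  have := sigmaFinite_rightCounting hX μ
  have hmeas : Measurable fun q : gibbsRel X =>
      ENNReal.ofReal (Real.exp (-cocycle f q.1.1 q.1.2)) :=
    (Real.measurable_exp.comp (hf.measurable_cocycle hd).neg).ennreal_ofReal
  constructor
  · rintro ⟨hqi, hD⟩
    obtain ⟨e, he⟩ := hX.exists_cover
    have hlr : leftCounting (gibbsRel X) μ ≪ rightCounting (gibbsRel X) μ :=
      absolutelyContinuous_of_comap (fun n => (e n).measurableEmbedding_graph) he fun n => by
        rw [comap_graph_leftCounting hX, comap_graph_rightCounting hX]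
        exact hqi.comap_coe_absolutelyContinuous (e n)
    have hrl : rightCounting (gibbsRel X) μ ≪ leftCounting (gibbsRel X) μ :=
      absolutelyContinuous_of_comap (fun n => (e n).measurableEmbedding_graph) he fun n => by
        rw [comap_graph_leftCounting hX, comap_graph_rightCounting hX]
        exact hqi.comap_absolutelyContinuous (e n)
    -- The derivative is known ν_r-almost everywhere but is integrated against ν_s, hence the need
    -- for ν_s ≪ ν_r; the other direction ν_r ≪ ν_s excludes a singular part.
    rw [isGibbsState_iff_leftCounting_eq hd hX hf, ← withDensity_congr_ae (hrl.ae_eq hD)]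
    exact (Measure.withDensity_rnDeriv_eq _ _ hlr).symm
  · intro h
    have heq := (isGibbsState_iff_leftCounting_eq hd hX hf μ).1 h
    refine ⟨h.quasiInvariant hX, ?_⟩
    have hac : leftCounting (gibbsRel X) μ ≪ rightCounting (gibbsRel X) μ := by
      rw [heq]
      exact withDensity_absolutelyContinuous _ _
    refine hac.ae_eq ?_
    rw [heq]
    exact Measure.rnDeriv_withDensity _ hmeas

end Main

end GibbsShift

theorem mainTheorem7 {d : ℕ} (hd : 0 < d) {A : Type*} [Finite A] [TopologicalSpace A]
    [DiscreteTopology A] [MeasurableSpace A] [BorelSpace A]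
    (X : Subshift d A) (hX : X.IsSFT) (f : X → ℝ) (hf : HasSummableVariation f) :
    (∀ x y : X, (x, y) ∈ gibbsRel X →
      Summable fun k : Fin d → ℤ => f (shift k y) - f (shift k x)) ∧
    IsFamilyOfMultipliers (gibbsMultiplier f) ∧
    ∀ μ : MeasureTheory.Measure X, MeasureTheory.IsProbabilityMeasure μ →
      (IsGibbsMeasure f μ ↔ IsGibbsState (gibbsMultiplier f) μ) := by
  refine ⟨fun x y h => hf.summable_cocycle hd h, isFamilyOfMultipliers_gibbsMultiplier hd hf,
    fun μ hμ => isGibbsMeasure_iff_isGibbsState hd hX hf μ⟩
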